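/- Let $T\ge 1$, let $a_1,\dots,a_T>0$ and $b_1,\dots,b_T$ be real numbers, extended $T$-periodically to all integer indices (so $a_0=a_T$), and let $J_T$ be the period-$T$ Jacobi operator $$(J_Tu)_1=b_1u_1+a_1u_2,\qquad (J_Tu)_n=a_{n-1}u_{n-1}+b_nu_n+a_nu_{n+1}\quad(n\ge 2).$$ For $\lambda\in\mathbb R$ put $$B_i(\lambda)=\begin{pmatrix}0&1\\-\frac{a_{i-1}}{a_i}&\frac{\lambda-b_i}{a_i}\end{pmatrix},\qquad M(\lambda)=B_T(\lambda)\cdots B_1(\lambda),$$ and $\sigma_{ell}(J_T)=\{\lambda\in\mathbb R:\ |\operatorname{Tr}M(\lambda)|<2\}$. For $\lambda\in\sigma_{ell}(J_T)$ let the quasi-momentum $\theta(\lambda)\in(0,\pi)$ be the unique number such that the eigenvalues of $M(\lambda)$ are $e^{\pm i\theta(\lambda)}$. Let $(\lambda_i)_{i\ge1}$ be an infinite sequence in $\sigma_{ell}(J_T)$ such that for every $k\ge 0$ the numbers $\pi,\theta(\lambda_1),\dots,\theta(\lambda_k)$ are linearly independent over $\mathbb Q$. Then for every sequence of positive real numbers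 $(K(n))_{n\ge1}$ with $K(n)\to\infty$ as $n\to\infty$ (however slowly), there exist a real potential $(q_n)_{n\ge1}$ with $$|q_n|\le\frac{K(n)}{n}\ \text{ for all } n\ge 1,\qquad q_n\to0,\qquad q_n=0\ \text{ unless } n\equiv1 \pmod T,$$ and, for every $i\ge1$, a non-zero real sequence $u^{(i)}=(u_{n,i})_{n\ge1}\in\ell^2(\mathbb N;\mathbb R)$ such that $$(J_T+Q)u^{(i)}=\lambda_iu^{(i)},$$ where $Q$ is the infinite diagonal matrix with entries $(q_n)$. -/

import Mathlib

open Filter Topology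

/-- A period-`T` Jacobi operator on the half-line, given by its weights `a_1, …, a_T > 0`
(off the diagonal) and `b_1, …, b_T` (on the diagonal).  The indices are read modulo `T`,
so that in particular `a_0 = a_T`.  The period `T` need not be minimal. -/
structure PeriodicJacobi (T : ℕ) where
  a : ZMod T → ℝ
  b : ZMod T → ℝ
  a_pos : ∀ i, 0 < a i

namespace PeriodicJacobi

variable {T : ℕ} (J : PeriodicJacobi T)

/-- The tridiagonal matrix `J_T` acting on real sequences `(u_n)_{n ≥ 1}`:
`(J_T u)_1 = b_1 u_1 + a_1 u_2` and
`(J_T u)_n = a_{n-1} u_{n-1} + b_n u_n + a_n u_{n+1}` for `n ≥ 2`.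
(On `ℓ²` this is the bounded Jacobi operator.) -/
def op : Module.End ℝ (ℕ+ → ℝ) where
  toFun u n := (if n = 1 then 0 else J.a (((n - 1 : ℕ+) : ℕ) : ZMod T) * u (n - 1))
    + J.b ((n : ℕ) : ZMod T) * u n + J.a ((n : ℕ) : ZMod T) * u (n + 1)
  map_add' u v := by
    funext n
    by_cases h : n = 1 <;> simp [h] <;> ring
  map_smul' c u := by
    funext n
    by_cases h : n = 1 <;> simp [h] <;> ring

/-- The transfer matrix `B_i(x)`. -/
noncomputable def transfer (i : ZMod T) (x : ℝ) : Matrix (Fin 2) (Fin 2) ℝ :=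
  !![0, 1; -(J.a (i - 1) / J.a i), (x - J.b i) / J.a i]

/-- The product `B_k(x) ⋯ B_1(x)` of the first `k` transfer matrices. -/
noncomputable def transferProd (x : ℝ) : ℕ → Matrix (Fin 2) (Fin 2) ℝ
  | 0 => 1
  | k + 1 => J.transfer ((k + 1 : ℕ) : ZMod T) x * transferProd x k

/-- The monodromy matrix `M(x) = B_T(x) ⋯ B_1(x)`. -/
noncomputable def monodromy (x : ℝ) : Matrix (Fin 2) (Fin 2) ℝ := J.transferProd x T

/-- The set of elliptic points `σ_ell(J_T)`. -/
def ellipticSet : Set ℝ := {x | |(J.monodromy x).trace| < 2}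

/-- `θ ∈ (0, π)` and the complex eigenvalues of `M(x)`, with multiplicity, are
`exp (i θ)` and `exp (-i θ)`. -/
def IsQuasiMomentum (x θ : ℝ) : Prop :=
  θ ∈ Set.Ioo 0 Real.pi ∧
    ((J.monodromy x).map (fun y : ℝ => (y : ℂ))).charpoly.roots =
      {Complex.exp (θ * Complex.I), Complex.exp (-(θ * Complex.I))}

theorem det_transferProd (x : ℝ) (k : ℕ) :
    (J.transferProd x k).det = J.a 0 / J.a (k : ZMod T) := by
  induction k with
  | zero => simp [transferProd, (J.a_pos 0).ne']
  | succ k ih =>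
    have h1 := (J.a_pos (k : ZMod T)).ne'
    have h2 := (J.a_pos ((k : ZMod T) + 1)).ne'
    rw [transferProd, Matrix.det_mul, ih]
    simp [transfer, Matrix.det_fin_two]
    field_simp

theorem det_monodromy (x : ℝ) : (J.monodromy x).det = 1 := by
  simp [monodromy, det_transferProd, (J.a_pos 0).ne']

theorem charpoly_roots_of_trace {M : Matrix (Fin 2) (Fin 2) ℝ} (hdet : M.det = 1) {θ : ℝ}
    (ht : M.trace = 2 * Real.cos θ) :
    (M.map (fun y : ℝ => (y : ℂ))).charpoly.roots =
      {Complex.exp (θ * Complex.I), Complex.exp (-(θ * Complex.I))} := by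
  have htr : (M.map (fun y : ℝ => (y : ℂ))).trace
      = Complex.exp (θ * Complex.I) + Complex.exp (-(θ * Complex.I)) := by
    have : (M.map (fun y : ℝ => (y : ℂ))).trace = ((M.trace : ℝ) : ℂ) := by
      simp [Matrix.trace_fin_two]
    rw [this, ht]
    push_cast
    rw [Complex.two_cos, neg_mul]
  have hd : (M.map (fun y : ℝ => (y : ℂ))).det
      = Complex.exp (θ * Complex.I) * Complex.exp (-(θ * Complex.I)) := by
    have : (M.map (fun y : ℝ => (y : ℂ))).det = ((M.det : ℝ) : ℂ) := by
      simp [Matrix.det_fin_two]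
    rw [this, hdet, ← Complex.exp_add]
    simp
  have hc : (M.map (fun y : ℝ => (y : ℂ))).charpoly
      = (Polynomial.X - Polynomial.C (Complex.exp (θ * Complex.I)))
        * (Polynomial.X - Polynomial.C (Complex.exp (-(θ * Complex.I)))) := by
    rw [Matrix.charpoly_fin_two, htr, hd]
    simp only [map_add, map_mul]
    ring
  rw [hc, Polynomial.roots_mul
    (mul_ne_zero (Polynomial.X_sub_C_ne_zero _) (Polynomial.X_sub_C_ne_zero _)),
    Polynomial.roots_X_sub_C, Polynomial.roots_X_sub_C]
  rfl

theorem trace_of_charpoly_roots {M : Matrix (Fin 2) (Fin 2) ℝ} {θ : ℝ}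
    (h : (M.map (fun y : ℝ => (y : ℂ))).charpoly.roots =
      {Complex.exp (θ * Complex.I), Complex.exp (-(θ * Complex.I))}) :
    M.trace = 2 * Real.cos θ := by
  have h1 := Matrix.trace_eq_sum_roots_charpoly (M.map (fun y : ℝ => (y : ℂ)))
  rw [h] at h1
  have h2 : (M.map (fun y : ℝ => (y : ℂ))).trace = ((M.trace : ℝ) : ℂ) := by
    simp [Matrix.trace_fin_two]
  have h3 : ((M.trace : ℝ) : ℂ) = ((2 * Real.cos θ : ℝ) : ℂ) := by
    rw [← h2, h1]
    push_cast
    rw [Complex.two_cos, neg_mul]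
    simp
  exact_mod_cast h3

/-- At an elliptic point the quasi-momentum exists and is unique. -/
theorem existsUnique_isQuasiMomentum (x : J.ellipticSet) : ∃! θ : ℝ, J.IsQuasiMomentum x θ := by
  have hx : |(J.monodromy x).trace| < 2 := x.2
  rw [abs_lt] at hx
  have hcos : Real.cos (Real.arccos ((J.monodromy x).trace / 2)) = (J.monodromy x).trace / 2 :=
    Real.cos_arccos (by linarith) (by linarith)
  refine ⟨Real.arccos ((J.monodromy x).trace / 2), ⟨⟨?_, ?_⟩, ?_⟩, ?_⟩
  · exact Real.arccos_pos.2 (by linarith)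
  · refine lt_of_le_of_ne (Real.arccos_le_pi _) fun h => ?_
    rw [h, Real.cos_pi] at hcos
    linarith
  · exact charpoly_roots_of_trace (J.det_monodromy x) (by rw [hcos]; ring)
  · rintro θ ⟨⟨h0, h1⟩, h2⟩
    rw [trace_of_charpoly_roots h2, mul_div_cancel_left₀ _ two_ne_zero,
      Real.arccos_cos h0.le h1.le]

/-- The quasi-momentum `θ : σ_ell(J_T) → (0, π)`: the eigenvalues of `M(x)` are
`exp (± i θ(x))`. -/
noncomputable def quasiMomentum (x : J.ellipticSet) : ℝ :=
  (J.existsUnique_isQuasiMomentum x).choose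

theorem quasiMomentum_spec (x : J.ellipticSet) : J.IsQuasiMomentum x (J.quasiMomentum x) :=
  (J.existsUnique_isQuasiMomentum x).choose_spec.1

end PeriodicJacobi

/-- The infinite diagonal matrix with entries `q_1, q_2, …`, acting on real sequences
`(u_n)_{n ≥ 1}`. -/
def diagOp (q : ℕ+ → ℝ) : Module.End ℝ (ℕ+ → ℝ) where
  toFun u n := q n * u n
  map_add' u v := by funext n; simp [mul_add]
  map_smul' c u := by funext n; simp [mul_left_comm]

/-! The potential is placed only at the sites `m T + 1`. For each `λ_i` a left eigenvector of the
monodromy matrix is a complex coordinate `z` on pairs `(u_{mT}, u_{mT+1})` in which a free block is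
multiplication by `ω_i = exp (i θ_i)`. A value `x m` of the potential precedes it with the kick `z ↦
z + x m * κ_i * Im z`, `κ_i ≠ 0`. All eigenvalues thus become rotations of the plane driven by one
common sequence of kicks (`PeriodicJacobi.blockCoord_succ`), and decay of every `z` like `1 / m`
gives `ℓ²` solutions.

To first order a kick changes `|z|²` by `x κ Im (z²)`. By independence of `π, θ_1, …, θ_j`, the
phases of finitely many `z_i²` reach any prescribed box within a time `N` independent of the
starting point (`exists_uniform_return`), so one kick can shrink `j` moduli at once
(`exists_uniform_good_time`).

Time is cut into windows `[s, s + N)` with one kick of size `C_j / (s + N)` each. The first `j`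
moduli shrink by `s / (s + N)`, which telescopes to `1 / m` (`exists_kicks`). The constant `C_j` may
be large, but `K → ∞` eventually dominates it; letting `j` grow slowly enough with `s` treats every
eigenvalue. -/

/-! ### Kronecker's theorem with a uniform return time. -/

theorem norm_geom_sum_le {w : ℂ} (hw : ‖w‖ = 1) (h1 : w ≠ 1) (N : ℕ) :
    ‖∑ t ∈ Finset.range N, w ^ t‖ ≤ 2 / ‖w - 1‖ := by
  rw [geom_sum_eq h1, norm_div]
  gcongr
  calc ‖w ^ N - 1‖ ≤ ‖w ^ N‖ + ‖(1 : ℂ)‖ := norm_sub_le _ _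
    _ = 2 := by rw [norm_pow, hw]; norm_num

/-- On the unit circle the Laurent polynomial `(1 + z)² / z` is real. -/
theorem sq_one_add_mul_inv {z : ℂ} (hz : ‖z‖ = 1) :
    (1 + z) ^ 2 * z⁻¹ = ((2 + 2 * z.re : ℝ) : ℂ) := by
  have h0 : z ≠ 0 := by rintro rfl; simp at hz
  have hi : z⁻¹ = (starRingEnd ℂ) z := by
    rw [Complex.inv_def, Complex.normSq_eq_norm_sq, hz]; simp
  have : (1 + z) ^ 2 * z⁻¹ = 2 + (z + z⁻¹) := by field_simp; ring
  rw [this, hi, Complex.add_conj]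
  push_cast; ring

theorem one_add_pow_mul_inv_pow (z : ℂ) (hz : z ≠ 0) (n : ℕ) :
    ((1 + z) ^ 2 * z⁻¹) ^ n =
      ∑ a ∈ Finset.range (2 * n + 1), ((2 * n).choose a : ℂ) * z ^ ((a : ℤ) - n) := by
  rw [mul_pow, ← pow_mul, add_comm, add_pow, Finset.sum_mul]
  refine Finset.sum_congr rfl fun a _ => ?_
  rw [zpow_sub₀ hz, zpow_natCast, zpow_natCast, one_pow, inv_pow]
  field_simp

/-- Sums of the kernel `∏ ((1 + z_i)² / z_i) ^ n` along an orbit of a rotation without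
multiplicative relations differ from their mean value by a bounded amount, uniformly in the
starting point. -/
theorem exists_norm_sum_kernel_sub_le {ι : Type*} [Fintype ι] [DecidableEq ι] (ω : ι → ℂ)
    (hω : ∀ i, ‖ω i‖ = 1) (hind : ∀ h : ι → ℤ, ∏ i, ω i ^ h i = 1 → h = 0) (n : ℕ) :
    ∃ E : ℝ, ∀ ζ : ι → ℂ, (∀ i, ‖ζ i‖ = 1) → ∀ N : ℕ,
      ‖∑ t ∈ Finset.range N, ∏ i, ((1 + ω i ^ t * ζ i) ^ 2 * (ω i ^ t * ζ i)⁻¹) ^ n -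
        N * (n.centralBinom : ℂ) ^ Fintype.card ι‖ ≤ E := by
  let S : Finset (ι → ℕ) := Fintype.piFinset fun _ => Finset.range (2 * n + 1)
  let Ω : (ι → ℕ) → ℂ := fun p => ∏ i, ω i ^ ((p i : ℤ) - n)
  let c : (ι → ℕ) → ℝ := fun p => ∏ i, ((2 * n).choose (p i) : ℝ)
  -- The erased index is the trivial character, which produces the mean. The other coefficients have
  -- modulus `c p` whatever `ζ` is, hence the uniformity.
  refine ⟨∑ p ∈ S.erase fun _ => n, c p * (2 / ‖Ω p - 1‖), fun ζ hζ N => ?_⟩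
  let A : (ι → ℕ) → ℂ := fun p => ∏ i, ((2 * n).choose (p i) : ℂ) * ζ i ^ ((p i : ℤ) - n)
  have hω0 : ∀ i, ω i ≠ 0 := fun i h => by simpa [h] using hω i
  have hζ0 : ∀ i, ζ i ≠ 0 := fun i h => by simpa [h] using hζ i
  have hexp : ∀ t : ℕ, ∏ i, ((1 + ω i ^ t * ζ i) ^ 2 * (ω i ^ t * ζ i)⁻¹) ^ n =
      ∑ p ∈ S, A p * Ω p ^ t := by
    intro t
    simp_rw [one_add_pow_mul_inv_pow _ (mul_ne_zero (pow_ne_zero t (hω0 _)) (hζ0 _))]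
    rw [Finset.prod_univ_sum]
    refine Finset.sum_congr rfl fun p _ => ?_
    simp only [A, Ω]
    rw [← Finset.prod_pow, ← Finset.prod_mul_distrib]
    refine Finset.prod_congr rfl fun i _ => ?_
    rw [mul_zpow, ← zpow_natCast, ← zpow_natCast, zpow_comm]
    ring
  have hmem : (fun _ => n) ∈ S := by simp [S]; omega
  have hmain : (∑ t ∈ Finset.range N, ∏ i, ((1 + ω i ^ t * ζ i) ^ 2 * (ω i ^ t * ζ i)⁻¹) ^ n) -
      N * (n.centralBinom : ℂ) ^ Fintype.card ι =
      ∑ p ∈ S.erase fun _ => n, A p * ∑ t ∈ Finset.range N, Ω p ^ t := by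
    simp_rw [hexp]
    rw [Finset.sum_comm, ← Finset.add_sum_erase S _ hmem]
    simp_rw [← Finset.mul_sum]
    simp [A, Ω, Nat.centralBinom_eq_two_mul_choose, mul_comm]
  rw [hmain]
  refine (norm_sum_le _ _).trans (Finset.sum_le_sum fun p hp => ?_)
  have hΩ : ‖Ω p‖ = 1 := by simp [Ω, hω]
  have hA : ‖A p‖ = c p := by simp [A, c, hζ]
  have hΩ1 : Ω p ≠ 1 := by
    intro h
    refine (Finset.mem_erase.1 hp).1 (funext fun i => ?_)
    have := congrFun (hind _ h) i
    simp only [Pi.zero_apply] at this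
    omega
  rw [norm_mul, hA]
  exact mul_le_mul_of_nonneg_left (norm_geom_sum_le hΩ hΩ1 N)
    (Finset.prod_nonneg fun _ _ => Nat.cast_nonneg _)

/-- In each factor the mean `centralBinom n` of the kernel is below its maximum `4 ^ n` only by a
polynomial factor, whereas leaving the box `Re ≥ 1/2` costs `(3 / 4) ^ n`. -/
theorem exists_pow_lt_centralBinom_pow (k : ℕ) :
    ∃ n : ℕ, ((4 : ℝ) ^ n) ^ k * (3 / 4) ^ n < (n.centralBinom : ℝ) ^ k := by
  have h := (tendsto_pow_const_mul_const_pow_of_abs_lt_one k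
    (r := 3 / 4) (by norm_num [abs_of_pos])).const_mul ((2 : ℝ) ^ k)
  rw [mul_zero] at h
  obtain ⟨n, hn, hn0⟩ := ((h.eventually_lt_const one_pos).and (eventually_gt_atTop 0)).exists
  refine ⟨n, ?_⟩
  have hc : (0 : ℝ) < n.centralBinom := by exact_mod_cast n.centralBinom_pos
  have h4 : (4 : ℝ) ^ n ≤ 2 * n * n.centralBinom := by
    exact_mod_cast Nat.four_pow_le_two_mul_self_mul_centralBinom n hn0
  calc ((4 : ℝ) ^ n) ^ k * (3 / 4) ^ n
      ≤ (2 * n * n.centralBinom) ^ k * (3 / 4) ^ n := by gcongr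
    _ = (2 ^ k * (n ^ k * (3 / 4) ^ n)) * n.centralBinom ^ k := by rw [mul_pow, mul_pow]; ring
    _ < 1 * n.centralBinom ^ k := by gcongr
    _ = _ := one_mul _

/-- A quantitative form of Kronecker's theorem: if `ω` has no multiplicative relations, then the
orbits of the rotation by `ω` on the torus visit the box `Re ≥ 1/2` within a time that does not
depend on the starting point. -/
theorem exists_uniform_return {ι : Type*} [Fintype ι] [DecidableEq ι] (ω : ι → ℂ)
    (hω : ∀ i, ‖ω i‖ = 1) (hind : ∀ h : ι → ℤ, ∏ i, ω i ^ h i = 1 → h = 0) :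
    ∃ N : ℕ, ∀ ζ : ι → ℂ, (∀ i, ‖ζ i‖ = 1) →
      ∃ t < N, ∀ i, 1 / 2 ≤ (ω i ^ t * ζ i).re := by
  obtain ⟨n, hn⟩ := exists_pow_lt_centralBinom_pow (Fintype.card ι)
  obtain ⟨E, hE⟩ := exists_norm_sum_kernel_sub_le ω hω hind n
  set k := Fintype.card ι
  set d : ℝ := (n.centralBinom : ℝ) ^ k - (4 ^ n) ^ k * (3 / 4) ^ n
  have hd : 0 < d := sub_pos.2 hn
  -- An orbit outside the box up to time `N` would put its kernel sum at least `N d` below `N` times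
  -- the mean; this must exceed the error `E`.
  obtain ⟨N, hN⟩ := exists_nat_gt (E / d)
  rw [div_lt_iff₀ hd] at hN
  refine ⟨N, fun ζ hζ => ?_⟩
  by_contra! hbad
  let W : ℕ → ℝ := fun t => ∏ i, (2 + 2 * (ω i ^ t * ζ i).re) ^ n
  have hz : ∀ t i, ‖ω i ^ t * ζ i‖ = 1 := fun t i => by simp [hω, hζ]
  have hre : ∀ t i, |(ω i ^ t * ζ i).re| ≤ 1 := fun t i =>
    (Complex.abs_re_le_norm _).trans (hz t i).le
  have hW : ∀ t ∈ Finset.range N, W t ≤ (4 ^ n) ^ k * (3 / 4) ^ n := by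
    intro t ht
    obtain ⟨j, hj⟩ := hbad t (Finset.mem_range.1 ht)
    calc W t ≤ ∏ i, 4 ^ n * (if i = j then (3 / 4 : ℝ) ^ n else 1) := by
          refine Finset.prod_le_prod (fun i _ => ?_) fun i _ => ?_
          · have := (abs_le.1 (hre t i)).1
            exact pow_nonneg (by linarith) _
          · have h1 := (abs_le.1 (hre t i)).1
            have h2 := (abs_le.1 (hre t i)).2
            split_ifs with h
            · rw [← mul_pow]
              subst h
              exact pow_le_pow_left₀ (by linarith) (by linarith) _
            · rw [mul_one]
              exact pow_le_pow_left₀ (by linarith) (by linarith) _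
      _ = _ := by
          rw [Finset.prod_mul_distrib, Finset.prod_const, Finset.prod_ite_eq']
          simp [k]
  have hsum : ∑ t ∈ Finset.range N, W t ≤ N * ((4 ^ n) ^ k * (3 / 4) ^ n) := by
    simpa using Finset.sum_le_sum hW
  have hEζ := hE ζ hζ N
  simp_rw [sq_one_add_mul_inv (hz _ _)] at hEζ
  have hcast : ∑ t ∈ Finset.range N, ∏ i, (((2 + 2 * (ω i ^ t * ζ i).re : ℝ) : ℂ)) ^ n -
      N * (n.centralBinom : ℂ) ^ k =
      ((∑ t ∈ Finset.range N, W t - N * (n.centralBinom : ℝ) ^ k : ℝ) : ℂ) := by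
    simp only [W]
    push_cast
    rfl
  rw [hcast, Complex.norm_real, Real.norm_eq_abs] at hEζ
  have := (abs_le.1 hEζ).1
  have hdN : (N : ℝ) * d = N * (n.centralBinom : ℝ) ^ k - N * ((4 ^ n) ^ k * (3 / 4) ^ n) := by
    simp only [d]; ring
  linarith

/-! ### Kicks and their effect on the modulus. -/

/-- One kick `z ↦ z + y Im z`, a shear of the plane that fixes the real axis. -/
noncomputable def imShear (y : ℝ) (z : ℂ) : ℂ := z + ((y * z.im : ℝ) : ℂ)

@[simp] theorem imShear_zero (z : ℂ) : imShear 0 z = z := by simp [imShear]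

/-- The first-order term depends on the phase of `z ^ 2`, which is why squares of the rotations
appear below. -/
theorem norm_imShear_sq (y : ℝ) (z : ℂ) :
    ‖imShear y z‖ ^ 2 = ‖z‖ ^ 2 + y * (z ^ 2).im + (y * z.im) ^ 2 := by
  rw [← Complex.normSq_eq_norm_sq, ← Complex.normSq_eq_norm_sq]
  simp [imShear, Complex.normSq_apply, pow_two]
  ring

/-- The quadratic term is at most `y² |z|²`, half of the linear gain. -/
theorem norm_imShear_sq_le {y g : ℝ} {z : ℂ} (hz : g * ‖z‖ ^ 2 ≤ -(y * (z ^ 2).im))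
    (hg : 2 * y ^ 2 ≤ g) : ‖imShear y z‖ ^ 2 ≤ (1 - g / 2) * ‖z‖ ^ 2 := by
  rw [norm_imShear_sq]
  have h1 : z.im ^ 2 ≤ ‖z‖ ^ 2 := sq_le_sq' (by
    linarith [(abs_le.1 (Complex.abs_im_le_norm z)).1]) (abs_le.1 (Complex.abs_im_le_norm z)).2
  have h2 : (y * z.im) ^ 2 ≤ g / 2 * ‖z‖ ^ 2 := by
    rw [mul_pow]
    exact mul_le_mul (by linarith) h1 (sq_nonneg _) (by nlinarith [sq_nonneg y])
  linarith

/-- Finitely many rotations without multiplicative relations: within a uniformly bounded time all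
the phases are such that a kick decreases the moduli. -/
theorem exists_uniform_good_time {ι : Type*} [Fintype ι] [DecidableEq ι] (ω : ι → ℂ)
    (hω : ∀ i, ‖ω i‖ = 1) (hind : ∀ h : ι → ℤ, ∏ i, (ω i ^ 2) ^ h i = 1 → h = 0)
    (κ : ι → ℝ) :
    ∃ N : ℕ, ∀ z : ι → ℂ, ∃ t < N, ∀ i,
      |κ i| / 2 * ‖ω i ^ t * z i‖ ^ 2 ≤ -(κ i * ((ω i ^ t * z i) ^ 2).im) := by
  obtain ⟨N, hN⟩ := exists_uniform_return (fun i => ω i ^ 2) (fun i => by simp [hω]) hind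
  refine ⟨N, fun z => ?_⟩
  let σ : ι → ℝ := fun i => if 0 ≤ κ i then 1 else -1
  have hσ : ∀ i, |σ i| = 1 := fun i => by simp only [σ]; split_ifs <;> simp
  have hσκ : ∀ i, |κ i| * σ i = κ i := fun i => by
    simp only [σ]
    split_ifs with h
    · rw [abs_of_nonneg h, mul_one]
    · rw [abs_of_neg (not_le.1 h)]; ring
  -- The factor `I` turns the real part into minus the imaginary part, and `σ i` matches the sign of
  -- `κ i`. For `z i = 0` the claim is trivial and any unit number serves.
  let ζ : ι → ℂ := fun i => if z i = 0 then 1 else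
    Complex.I * σ i * (z i ^ 2 / ((‖z i‖ ^ 2 : ℝ) : ℂ))
  have hζ : ∀ i, ‖ζ i‖ = 1 := by
    intro i
    simp only [ζ]
    split_ifs with h
    · simp
    · have : ‖z i‖ ≠ 0 := norm_ne_zero_iff.2 h
      simp [hσ, this]
  obtain ⟨t, ht, h⟩ := hN ζ hζ
  refine ⟨t, ht, fun i => ?_⟩
  by_cases hz : z i = 0
  · simp [hz]
  have hpos : 0 < ‖z i‖ ^ 2 := by positivity
  have hre : ((ω i ^ 2) ^ t * ζ i).re = -(σ i * ((ω i ^ t * z i) ^ 2).im) / ‖z i‖ ^ 2 := by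
    have : (ω i ^ 2) ^ t * ζ i =
        (((σ i / ‖z i‖ ^ 2 : ℝ) : ℂ) * (ω i ^ t * z i) ^ 2) * Complex.I := by
      simp only [ζ, if_neg hz]
      push_cast
      ring
    rw [this, Complex.mul_I_re, Complex.im_ofReal_mul]
    ring
  have hi := h i
  rw [hre, le_div_iff₀ hpos] at hi
  have hn : ‖ω i ^ t * z i‖ = ‖z i‖ := by simp [hω]
  rw [hn]
  have := mul_le_mul_of_nonneg_left hi (abs_nonneg (κ i))
  calc |κ i| / 2 * ‖z i‖ ^ 2 = |κ i| * (1 / 2 * ‖z i‖ ^ 2) := by ring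
    _ ≤ _ := this
    _ = _ := by rw [← hσκ i, abs_mul, abs_abs, hσ]; ring

/-! ### Windows with a single kick. -/

/-- The parameters `(N, t, v)` of a single kick of size `v` at the time `s + t z` in the window
`[s, s + N)` are admissible, and make the first `j` moduli decay at least like `1 / s`. -/
structure KickWindow (T : ℕ) (K : ℕ → ℝ) (ω : ℕ → ℂ) (κ : ℕ → ℝ) (j s : ℕ) where
  N : ℕ
  t : (ℕ → ℂ) → ℕ
  v : ℝ
  N_pos : 0 < N
  N_le : N ≤ s + 1
  t_lt : ∀ z, t z < N
  v_nonneg : 0 ≤ v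
  v_mul_le : v * j ≤ 1
  v_le : ∀ m, s ≤ m → m < s + N → v ≤ K (m * T + 1) / ((m * T + 1 : ℕ) : ℝ)
  norm_le : ∀ z, ∀ i < j, ‖imShear (v * κ i) (ω i ^ t z * z i)‖ * ((s + N : ℕ) : ℝ) ≤ s * ‖z i‖

namespace KickWindow

variable {T : ℕ} {K : ℕ → ℝ} {ω : ℕ → ℂ} {κ : ℕ → ℝ}

theorem nonempty_zero (hK : ∀ n, 0 ≤ K n) (s : ℕ) : Nonempty (KickWindow T K ω κ 0 s) :=
  ⟨{ N := 1, t := fun _ => 0, v := 0, N_pos := one_pos, N_le := by omega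
     t_lt := fun _ => one_pos, v_nonneg := le_rfl, v_mul_le := by simp
     v_le := fun m _ _ => div_nonneg (hK _) (Nat.cast_nonneg _)
     norm_le := fun _ i hi => absurd hi (Nat.not_lt_zero i) }⟩

theorem eventually_nonempty (hT : 1 ≤ T) (hKt : Tendsto K atTop atTop)
    (hω : ∀ i, ‖ω i‖ = 1)
    (hind : ∀ k, ∀ h : Fin k → ℤ, ∏ i : Fin k, (ω i ^ 2) ^ h i = 1 → h = 0)
    (hκ : ∀ i, κ i ≠ 0) (j : ℕ) : ∀ᶠ s in atTop, Nonempty (KickWindow T K ω κ j s) := by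
  obtain ⟨N, hN⟩ := exists_uniform_good_time (fun i : Fin j => ω i) (fun i => hω i) (hind j)
    (fun i => κ i)
  obtain ⟨δ, hδ0, hδ⟩ : ∃ δ > 0, ∀ i : Fin j, δ ≤ |κ i| := by
    rcases isEmpty_or_nonempty (Fin j) with h | h
    · exact ⟨1, one_pos, fun i => h.elim i⟩
    · obtain ⟨i, hi⟩ := Finite.exists_min fun i : Fin j => |κ i|
      exact ⟨_, abs_pos.2 (hκ i), hi⟩
  obtain ⟨D, hD⟩ : ∃ D, ∀ i : Fin j, |κ i| ≤ D := by
    obtain ⟨D, hD⟩ := (Set.finite_range fun i : Fin j => |κ i|).bddAbove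
    exact ⟨D, fun i => hD ⟨i, rfl⟩⟩
  have hNpos : 0 < N := by
    obtain ⟨t, ht, -⟩ := hN 0
    omega
  -- With this kick size the relative gain `v |κ i| / 4` in the squared modulus is at least `2 N /
  -- (s + N)`, enough for the factor `(s / (s + N))²`.
  have hv : Tendsto (fun s : ℕ => 8 * N / δ / ((s + N : ℕ) : ℝ)) atTop (𝓝 0) :=
    (tendsto_const_div_atTop_nhds_zero_nat (8 * N / δ)).comp (tendsto_add_atTop_nat N)
  have hv1 := hv.mul_const (j : ℝ)
  have hv2 := hv.mul_const (4 * D)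
  rw [zero_mul] at hv1 hv2
  -- The threshold depends on `j` through `N` and `δ`; divergence of `K` is what makes it attainable
  -- for every `j`.
  obtain ⟨n₀, hn₀⟩ := eventually_atTop.1 (hKt.eventually_ge_atTop (8 * N / δ * T))
  filter_upwards [hv1.eventually_le_const one_pos, hv2.eventually_le_const one_pos,
    eventually_ge_atTop N, eventually_ge_atTop n₀] with s h1 h2 hs hs0
  choose t ht htz using hN
  set v : ℝ := 8 * N / δ / ((s + N : ℕ) : ℝ) with hvdef
  have hsN : (0 : ℝ) < ((s + N : ℕ) : ℝ) := by exact_mod_cast (by omega : 0 < s + N)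
  have hvpos : 0 < v := by positivity
  refine ⟨{ N := N, t := fun z => t fun i => z i, v := v, N_pos := hNpos, N_le := by omega
            t_lt := fun z => ht _, v_nonneg := hvpos.le, v_mul_le := h1
            v_le := fun m hm hm' => ?_, norm_le := fun z i hi => ?_ }⟩
  · have hmT : m ≤ m * T := Nat.le_mul_of_pos_right m hT
    have hK' := hn₀ (m * T + 1) (by omega)
    have hpos : (0 : ℝ) < ((m * T + 1 : ℕ) : ℝ) := by positivity
    rw [le_div_iff₀ hpos]
    have hle : ((m * T + 1 : ℕ) : ℝ) ≤ T * ((s + N : ℕ) : ℝ) := by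
      have : m * T + 1 ≤ T * (s + N) := by
        have := Nat.mul_le_mul_right T (show m + 1 ≤ s + N by omega)
        rw [mul_comm T]
        linarith [Nat.add_mul m 1 T]
      exact_mod_cast this
    calc v * ((m * T + 1 : ℕ) : ℝ) ≤ v * (T * ((s + N : ℕ) : ℝ)) := by gcongr
      _ = 8 * N / δ * T := by rw [hvdef]; field_simp
      _ ≤ _ := hK'
  · have hg := htz (fun i : Fin j => z i) ⟨i, hi⟩
    have hκi := hδ ⟨i, hi⟩
    have hκD := hD ⟨i, hi⟩
    simp only at hg hκi hκD
    set w := ω i ^ t (fun i : Fin j => z i) * z i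
    have hw : ‖w‖ = ‖z i‖ := by simp [w, hω]
    have hA : ‖imShear (v * κ i) w‖ ^ 2 ≤ (1 - v * |κ i| / 2 / 2) * ‖w‖ ^ 2 := by
      apply norm_imShear_sq_le
      · have := mul_le_mul_of_nonneg_left hg hvpos.le
        calc v * |κ i| / 2 * ‖w‖ ^ 2 = v * (|κ i| / 2 * ‖w‖ ^ 2) := by ring
          _ ≤ _ := this
          _ = _ := by ring
      · have : v * (4 * |κ i|) ≤ 1 := le_trans (by gcongr) h2
        calc 2 * (v * κ i) ^ 2 = v * (4 * |κ i|) * (v * |κ i| / 2) := by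
              rw [mul_pow, ← sq_abs (κ i)]; ring
          _ ≤ 1 * (v * |κ i| / 2) := by gcongr
          _ = _ := one_mul _
    have hB : (1 - v * |κ i| / 2 / 2) * ((s + N : ℕ) : ℝ) ^ 2 ≤ (s : ℝ) ^ 2 := by
      have : 8 * (N : ℝ) ≤ v * |κ i| * ((s + N : ℕ) : ℝ) := by
        calc 8 * (N : ℝ) = v * δ * ((s + N : ℕ) : ℝ) := by rw [hvdef]; field_simp
          _ ≤ _ := by gcongr
      push_cast at this hsN ⊢
      -- `(s + N)² - 2 N (s + N) = s² - N² ≤ s²`.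
      nlinarith [sq_nonneg (N : ℝ)]
    refine le_of_sq_le_sq ?_ (by positivity)
    rw [mul_pow, mul_pow]
    calc ‖imShear (v * κ i) w‖ ^ 2 * ((s + N : ℕ) : ℝ) ^ 2
        ≤ (1 - v * |κ i| / 2 / 2) * ‖w‖ ^ 2 * ((s + N : ℕ) : ℝ) ^ 2 := by gcongr
      _ = (1 - v * |κ i| / 2 / 2) * ((s + N : ℕ) : ℝ) ^ 2 * ‖w‖ ^ 2 := by ring
      _ ≤ (s : ℝ) ^ 2 * ‖w‖ ^ 2 := by gcongr
      _ = _ := by rw [hw]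

/-- A choice of windows in which the number of controlled moduli tends to infinity. -/
theorem exists_stage (hK : ∀ n, 0 ≤ K n)
    (h : ∀ j, ∀ᶠ s in atTop, Nonempty (KickWindow T K ω κ j s)) :
    ∃ j : ℕ → ℕ, Tendsto j atTop atTop ∧ ∀ s, Nonempty (KickWindow T K ω κ (j s) s) := by
  classical
  -- The largest feasible `j ≤ s`; `j = 0` is always feasible.
  refine ⟨fun s => Nat.findGreatest (fun j => Nonempty (KickWindow T K ω κ j s)) s,
    tendsto_atTop.2 fun i => ?_, fun s => ?_⟩
  · filter_upwards [h i, eventually_ge_atTop i] with s hs his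
    exact Nat.le_findGreatest his hs
  · exact Nat.findGreatest_spec (P := fun j => Nonempty (KickWindow T K ω κ j s))
      (Nat.zero_le s) (nonempty_zero hK s)

end KickWindow

/-! ### Concatenating windows and running the feedback. -/

/-- The start of the window that contains `m`, for consecutive windows `[s, s + N s)`. -/
def windowStart (N : ℕ → ℕ) : ℕ → ℕ
  | 0 => 0
  | m + 1 => if m + 1 = windowStart N m + N (windowStart N m) then m + 1 else windowStart N m

section windowStart

variable {N : ℕ → ℕ}

theorem windowStart_le (N : ℕ → ℕ) (m : ℕ) : windowStart N m ≤ m := by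
  induction m with
  | zero => simp [windowStart]
  | succ m ih =>
    rw [windowStart]
    split_ifs <;> omega

theorem lt_windowStart_add (hN : ∀ s, 0 < N s) (m : ℕ) :
    m < windowStart N m + N (windowStart N m) := by
  induction m with
  | zero => simp [windowStart, hN]
  | succ m ih =>
    rw [windowStart]
    split_ifs with h
    · have := hN (m + 1); omega
    · omega

theorem windowStart_add {s : ℕ} (hs : windowStart N s = s) {r : ℕ} (hr : r < N s) :
    windowStart N (s + r) = s := by
  induction r with
  | zero => exact hs
  | succ r ih =>
    have := ih (by omega)
    rw [← add_assoc, windowStart, this, if_neg (by omega)]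

theorem windowStart_windowStart (N : ℕ → ℕ) (m : ℕ) :
    windowStart N (windowStart N m) = windowStart N m := by
  induction m with
  | zero => simp [windowStart]
  | succ m ih =>
    by_cases h : m + 1 = windowStart N m + N (windowStart N m)
    · have : windowStart N (m + 1) = m + 1 := by rw [windowStart, if_pos h]
      rw [this, this]
    · have : windowStart N (m + 1) = windowStart N m := by rw [windowStart, if_neg h]
      rw [this, ih]

end windowStart

/-- A feedback orbit: the parameter of the step at time `m` depends on the state at the earlier
time `start m`. -/
def feedbackOrbit {X : Type*} (step : ℝ → X → X) (start : ℕ → ℕ) (g : ℕ → X → ℝ) (z₀ : X) :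
    ℕ → X
  | 0 => z₀
  | m + 1 => step (g m (feedbackOrbit step start g z₀ (min (start m) m)))
      (feedbackOrbit step start g z₀ m)
termination_by m => m

/-- The `min` in `feedbackOrbit` only secures termination; it disappears because `start m ≤ m`. -/
theorem exists_feedback_orbit {X : Type*} (step : ℝ → X → X) (start : ℕ → ℕ)
    (hstart : ∀ m, start m ≤ m) (g : ℕ → X → ℝ) (z₀ : X) :
    ∃ z : ℕ → X, z 0 = z₀ ∧ ∀ m, z (m + 1) = step (g m (z (start m))) (z m) :=
  ⟨feedbackOrbit step start g z₀, by rw [feedbackOrbit], fun m => by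
    rw [feedbackOrbit, min_eq_left (hstart m)]⟩

/-- An orbit of a rotation with a single kick in the window. -/
theorem orbit_of_single_kick {ω : ℂ} {N τ : ℕ} (hτ : τ < N) {y : ℝ} {z : ℕ → ℂ}
    (h : ∀ r < N, z (r + 1) = ω * imShear (if r = τ then y else 0) (z r)) :
    (∀ r ≤ τ, z r = ω ^ r * z 0) ∧
      ∀ r, τ < r → r ≤ N → z r = ω ^ (r - τ) * imShear y (ω ^ τ * z 0) := by
  have h1 : ∀ r ≤ τ, z r = ω ^ r * z 0 := by
    intro r hr
    induction r with
    | zero => simp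
    | succ r ih =>
      rw [h r (by omega), if_neg (by omega), imShear_zero, ih (by omega)]
      ring
  refine ⟨h1, fun r hr => ?_⟩
  induction r, hr using Nat.le_induction with
  | base =>
    intro _
    rw [h τ hτ, if_pos rfl, h1 τ le_rfl]
    simp
  | succ r hr ih =>
    intro hrN
    rw [h r (by omega), if_neg (by simp at hr; omega), imShear_zero, ih (by omega),
      show r + 1 - τ = (r - τ) + 1 by simp at hr; omega]
    ring

theorem exists_forall_le_of_forall_ge {f : ℕ → ℝ} {M : ℕ} {C : ℝ} (h : ∀ m ≥ M, f m ≤ C) :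
    ∃ C', ∀ m, f m ≤ C' := by
  obtain ⟨B, hB⟩ := ((Finset.range M).image f).bddAbove
  refine ⟨max B C, fun m => ?_⟩
  rcases lt_or_ge m M with hm | hm
  · exact le_max_of_le_left (hB (by simpa using ⟨m, hm, rfl⟩))
  · exact le_max_of_le_right (h m hm)

/-- A single sequence of kicks `x m = O(K m / m)` makes the moduli of countably many rotating
points decay like `1 / m`. -/
theorem exists_kicks {T : ℕ} (hT : 1 ≤ T) {K : ℕ → ℝ} (hK : ∀ n, 0 ≤ K n)
    (hKt : Tendsto K atTop atTop) {ω : ℕ → ℂ} (hω : ∀ i, ‖ω i‖ = 1)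
    (hind : ∀ k, ∀ h : Fin k → ℤ, ∏ i : Fin k, (ω i ^ 2) ^ h i = 1 → h = 0)
    {κ : ℕ → ℝ} (hκ : ∀ i, κ i ≠ 0) (z₀ : ℕ → ℂ) :
    ∃ x : ℕ → ℝ, (∀ m, 0 ≤ x m) ∧ (∀ m, x m ≤ K (m * T + 1) / ((m * T + 1 : ℕ) : ℝ)) ∧
      Tendsto x atTop (𝓝 0) ∧ ∃ z : ℕ → ℕ → ℂ, z 0 = z₀ ∧
        (∀ m i, z (m + 1) i = ω i * imShear (x m * κ i) (z m i)) ∧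
        ∀ i, ∃ C, ∀ m, ‖z m i‖ * (m + 1) ≤ C := by
  obtain ⟨j, hj, hw⟩ := KickWindow.exists_stage hK
    (KickWindow.eventually_nonempty hT hKt hω hind hκ)
  have w := fun s => (hw s).some
  let N : ℕ → ℕ := fun s => (w s).N
  have hN : ∀ s, 0 < N s := fun s => (w s).N_pos
  let τ : ℕ → (ℕ → ℂ) → ℕ := fun s => (w s).t
  let v : ℕ → ℝ := fun s => (w s).v
  let start := windowStart N
  -- The kick time of a window is decided by the state at its start, so `z` here stands for that
  -- earlier state.
  let g : ℕ → (ℕ → ℂ) → ℝ := fun m z =>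
    if m = start m + τ (start m) z then v (start m) else 0
  obtain ⟨z, hz0, hz⟩ := exists_feedback_orbit
    (fun (x : ℝ) (z : ℕ → ℂ) i => ω i * imShear (x * κ i) (z i)) start (windowStart_le N) g z₀
  -- From `m < s + N s` and `N s ≤ s + 1`: windows at most double the time, so decay at window
  -- starts carries over to all times.
  have hle : ∀ m, m ≤ 2 * start m := fun m => by
    have h1 := lt_windowStart_add hN m
    have h2 := (w (start m)).N_le
    change m < start m + (w (start m)).N at h1
    omega
  have hstart : Tendsto start atTop atTop := tendsto_atTop.2 fun b => by
    filter_upwards [eventually_ge_atTop (2 * b)] with m hm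
    have := hle m
    omega
  have hx0 : ∀ m, 0 ≤ g m (z (start m)) := fun m => by
    simp only [g]
    split_ifs
    exacts [(w _).v_nonneg, le_rfl]
  have hxv : ∀ m, g m (z (start m)) ≤ (w (start m)).v := fun m => by
    simp only [g]
    split_ifs
    exacts [le_rfl, (w _).v_nonneg]
  refine ⟨fun m => g m (z (start m)), hx0, fun m => ?_, ?_, z, hz0,
    fun m i => congrFun (hz m) i, fun i => ?_⟩
  · exact (hxv m).trans ((w (start m)).v_le m (windowStart_le N m) (lt_windowStart_add hN m))
  · have hjs : Tendsto (fun m => 1 / (j (start m) : ℝ)) atTop (𝓝 0) :=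
      tendsto_one_div_atTop_nhds_zero_nat.comp (hj.comp hstart)
    refine tendsto_of_tendsto_of_tendsto_of_le_of_le' tendsto_const_nhds hjs
      (Eventually.of_forall hx0) ?_
    filter_upwards [(hj.comp hstart).eventually_gt_atTop 0] with m hm
    refine (hxv m).trans ?_
    rw [le_div_iff₀ (by exact_mod_cast hm)]
    exact (w (start m)).v_mul_le
  · have hwin : ∀ s, start s = s → i < j s →
        (∀ r < N s, ‖z (s + r) i‖ ≤ ‖z s i‖) ∧
          ‖z (s + N s) i‖ * ((s + N s : ℕ) : ℝ) ≤ s * ‖z s i‖ := by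
      intro s hs hi
      have hkick := (w s).norm_le (z s) i hi
      have hdec : ‖imShear ((w s).v * κ i) (ω i ^ (w s).t (z s) * z s i)‖ ≤ ‖z s i‖ := by
        have hpos : (0 : ℝ) < ((s + N s : ℕ) : ℝ) := by
          exact_mod_cast (by have := hN s; omega : 0 < s + N s)
        refine le_of_mul_le_mul_right (hkick.trans ?_) hpos
        rw [mul_comm]
        gcongr
        exact Nat.le_add_right _ _
      obtain ⟨hb, ha⟩ := orbit_of_single_kick (ω := ω i) ((w s).t_lt (z s))
        (y := (w s).v * κ i) (z := fun r => z (s + r) i) (fun r hr => by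
          have hsr : start (s + r) = s := windowStart_add hs hr
          have := congrFun (hz (s + r)) i
          have hg : g (s + r) (z s) = if r = (w s).t (z s) then (w s).v else 0 := by
            change (if s + r = start (s + r) + τ (start (s + r)) (z s) then
              v (start (s + r)) else 0) = if r = τ s (z s) then v s else 0
            rw [hsr]
            simp
          rw [hsr] at this
          rw [← add_assoc, this, hg]
          by_cases h : r = (w s).t (z s)
          · simp [h]
          · simp [h])
      simp only [add_zero] at hb ha
      refine ⟨fun r hr => ?_, ?_⟩
      · rcases le_or_gt r ((w s).t (z s)) with h | h
        · rw [hb r h]; simp [hω]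
        · rw [ha r h (le_of_lt hr)]; simpa [hω] using hdec
      · change ‖z (s + (w s).N) i‖ * _ ≤ _
        rw [ha _ ((w s).t_lt _) le_rfl]
        simpa [hω] using hkick
    obtain ⟨M, hM⟩ := eventually_atTop.1 (hj.eventually_gt_atTop i)
    obtain ⟨s₀, hs₀M, hs₀⟩ : ∃ s₀, M ≤ s₀ ∧ start s₀ = s₀ :=
      ⟨start (2 * M), by have := hle (2 * M); omega, windowStart_windowStart N _⟩
    -- Once index `i` is controlled, `s ‖z s i‖` does not increase from one window start to the
    -- next.
    have hinv : ∀ m ≥ s₀, s₀ ≤ start m ∧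
        (start m : ℝ) * ‖z (start m) i‖ ≤ s₀ * ‖z s₀ i‖ := by
      intro m hm
      induction m, hm using Nat.le_induction with
      | base => rw [hs₀]; exact ⟨le_rfl, le_rfl⟩
      | succ m hm ih =>
        by_cases h : m + 1 = start m + N (start m)
        · have h' : start (m + 1) = m + 1 := by
            change windowStart N (m + 1) = m + 1
            rw [windowStart, if_pos h]
          refine ⟨by omega, ?_⟩
          have := (hwin (start m) (windowStart_windowStart N m)
            (hM _ (hs₀M.trans ih.1))).2
          rw [← h] at this
          rw [h', mul_comm]
          exact this.trans ih.2
        · have h' : start (m + 1) = start m := by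
            change windowStart N (m + 1) = windowStart N m
            rw [windowStart, if_neg h]
          rw [h']
          exact ih
    -- Beyond `s₀` one has `start m ≥ 1`, so `m + 1 ≤ 2 * start m + 1 ≤ 3 * start m`.
    refine exists_forall_le_of_forall_ge (M := s₀ + 1) (C := 3 * (s₀ * ‖z s₀ i‖)) fun m hm => ?_
    obtain ⟨h1, h2⟩ := hinv m (by omega)
    have h3 : ‖z m i‖ ≤ ‖z (start m) i‖ := by
      have hlt := lt_windowStart_add hN m
      have hge : start m ≤ m := windowStart_le N m
      have := (hwin (start m) (windowStart_windowStart N m) (hM _ (hs₀M.trans h1))).1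
        (m - start m) (by change m < start m + N (start m) at hlt; omega)
      rwa [Nat.add_sub_cancel' hge] at this
    have h4 : (m : ℝ) + 1 ≤ 3 * start m := by
      have := hle m
      exact_mod_cast (by omega : m + 1 ≤ 3 * start m)
    calc ‖z m i‖ * (m + 1) ≤ ‖z (start m) i‖ * (3 * start m) := by gcongr
      _ = 3 * (start m * ‖z (start m) i‖) := by ring
      _ ≤ _ := by gcongr

/-! ### Quasi-momenta and rotation coordinates. -/

/-- A multiplicative relation says `2 ∑ h i * θ i = 2 π n`; including `π` in the independent family
excludes it, and the squares are harmless. -/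
theorem prod_exp_sq_zpow_eq_one {k : ℕ} {θ : Fin k → ℝ}
    (hθ : LinearIndependent ℚ (Fin.cons Real.pi θ : Fin (k + 1) → ℝ)) (h : Fin k → ℤ)
    (hp : ∏ i, (Complex.exp (θ i * Complex.I) ^ 2) ^ h i = 1) : h = 0 := by
  have h1 : ∏ i, (Complex.exp (θ i * Complex.I) ^ 2) ^ h i =
      Complex.exp (2 * ((∑ i, h i * θ i : ℝ) : ℂ) * Complex.I) := by
    push_cast
    rw [Finset.mul_sum, Finset.sum_mul, Complex.exp_sum]
    refine Finset.prod_congr rfl fun i _ => ?_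
    rw [← Complex.exp_nat_mul, ← Complex.exp_int_mul]
    congr 1
    push_cast
    ring
  rw [h1, Complex.exp_eq_one_iff] at hp
  obtain ⟨n, hn⟩ := hp
  have h2 : (∑ i, h i * θ i : ℝ) = n * Real.pi := by
    have h3 : ((∑ i, h i * θ i : ℝ) : ℂ) = ((n * Real.pi : ℝ) : ℂ) := by
      have := mul_right_cancel₀ Complex.I_ne_zero
        (show (2 * ((∑ i, h i * θ i : ℝ) : ℂ)) * Complex.I = (2 * (n * Real.pi)) * Complex.I by
          rw [hn]; ring)
      have := mul_left_cancel₀ two_ne_zero this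
      rw [this]
      push_cast
      rfl
    exact_mod_cast h3
  have h4 := Fintype.linearIndependent_iff.1 hθ (Fin.cons (-n : ℚ) fun i => (h i : ℚ)) (by
    rw [Fin.sum_univ_succ]
    simp only [Fin.cons_zero, Fin.cons_succ, Rat.smul_def]
    push_cast
    linarith)
  funext i
  have := h4 i.succ
  simpa using this

/-- A left eigenvector of `M`, as a functional: if `det M = 1` and `M` has trace `2 cos θ`, its
eigenvalue is `exp (i θ)`. -/
noncomputable def rotationCoord (M : Matrix (Fin 2) (Fin 2) ℝ) (θ : ℝ) (v : Fin 2 → ℝ) : ℂ :=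
  M 1 0 * v 0 + (Complex.exp (θ * Complex.I) - M 0 0) * v 1

section rotationCoord

variable {M : Matrix (Fin 2) (Fin 2) ℝ} {θ : ℝ}

theorem rotationCoord_mulVec (hdet : M.det = 1) (htr : M.trace = 2 * Real.cos θ)
    (v : Fin 2 → ℝ) :
    rotationCoord M θ (M.mulVec v) = Complex.exp (θ * Complex.I) * rotationCoord M θ v := by
  have hd : (M 0 0 : ℂ) * M 1 1 - M 0 1 * M 1 0 = 1 := by
    rw [Matrix.det_fin_two] at hdet
    exact_mod_cast hdet
  have ht : (M 0 0 : ℂ) + M 1 1 =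
      Complex.exp (θ * Complex.I) + Complex.exp (-(θ * Complex.I)) := by
    have h : ((M 0 0 + M 1 1 : ℝ) : ℂ) = ((2 * Real.cos θ : ℝ) : ℂ) := by
      rw [← htr, Matrix.trace_fin_two]
    push_cast at h
    rw [h, Complex.two_cos, neg_mul]
  have he : Complex.exp (θ * Complex.I) * Complex.exp (-(θ * Complex.I)) = 1 := by
    rw [← Complex.exp_add]; simp
  set E := Complex.exp (θ * Complex.I)
  set E' := Complex.exp (-(θ * Complex.I))
  simp only [rotationCoord, Matrix.mulVec, dotProduct, Fin.sum_univ_two]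
  push_cast
  linear_combination (-(v 1 : ℂ)) * hd + (v 1 : ℂ) * E * ht + (v 1 : ℂ) * he

theorem rotationCoord_im (v : Fin 2 → ℝ) : (rotationCoord M θ v).im = Real.sin θ * v 1 := by
  simp [rotationCoord, Complex.exp_ofReal_mul_I_im]

/-- A triangular real matrix of determinant 1 has diagonal `a, 1/a`, hence `|trace| ≥ 2`. -/
theorem entry_ne_zero_of_abs_trace_lt (hdet : M.det = 1) (htr : |M.trace| < 2) : M 1 0 ≠ 0 := by
  intro h
  rw [Matrix.det_fin_two, h] at hdet
  rw [Matrix.trace_fin_two, abs_lt] at htr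
  nlinarith [sq_nonneg (M 0 0 - M 1 1)]

/-- The coordinate is a real isomorphism onto `ℂ`: the imaginary part recovers `v 1`, and then `M 1
0 ≠ 0` recovers `v 0`. -/
theorem exists_abs_le_norm_rotationCoord (hM : M 1 0 ≠ 0) (hθ : Real.sin θ ≠ 0) :
    ∃ c : ℝ, 0 ≤ c ∧ ∀ v, |v 0| ≤ c * ‖rotationCoord M θ v‖ ∧
      |v 1| ≤ c * ‖rotationCoord M θ v‖ := by
  set e : ℝ := ‖Complex.exp (θ * Complex.I) - M 0 0‖
  have h1 : ∀ v, |v 1| ≤ |Real.sin θ|⁻¹ * ‖rotationCoord M θ v‖ := fun v => by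
    have := Complex.abs_im_le_norm (rotationCoord M θ v)
    rw [rotationCoord_im, abs_mul] at this
    rw [inv_mul_eq_div, le_div_iff₀ (abs_pos.2 hθ), mul_comm]
    exact this
  have h0 : ∀ v, |v 0| ≤ |M 1 0|⁻¹ * (1 + e * |Real.sin θ|⁻¹) * ‖rotationCoord M θ v‖ :=
    fun v => by
    have h2 : |M 1 0| * |v 0| ≤ ‖rotationCoord M θ v‖ + e * |v 1| := by
      have : ((M 1 0 * v 0 : ℝ) : ℂ) = rotationCoord M θ v -
          (Complex.exp (θ * Complex.I) - M 0 0) * v 1 := by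
        simp [rotationCoord]
      rw [← abs_mul, ← Real.norm_eq_abs, ← Complex.norm_real, this]
      refine (norm_sub_le _ _).trans_eq ?_
      rw [norm_mul, Complex.norm_real, Real.norm_eq_abs]
    have h3 : e * |v 1| ≤ e * (|Real.sin θ|⁻¹ * ‖rotationCoord M θ v‖) :=
      mul_le_mul_of_nonneg_left (h1 v) (norm_nonneg _)
    rw [mul_assoc, inv_mul_eq_div, le_div_iff₀ (abs_pos.2 hM), mul_comm]
    linarith
  refine ⟨max (|Real.sin θ|⁻¹) (|M 1 0|⁻¹ * (1 + e * |Real.sin θ|⁻¹)),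
    le_max_of_le_left (by positivity), fun v => ⟨(h0 v).trans ?_, (h1 v).trans ?_⟩⟩
  · gcongr; exact le_max_right _ _
  · gcongr; exact le_max_left _ _

end rotationCoord

/-! ### Solutions of the perturbed equation, block by block. -/

namespace PeriodicJacobi

variable {T : ℕ} (J : PeriodicJacobi T)

theorem trace_monodromy (x : J.ellipticSet) :
    (J.monodromy x).trace = 2 * Real.cos (J.quasiMomentum x) :=
  trace_of_charpoly_roots (J.quasiMomentum_spec x).2

theorem sin_quasiMomentum_pos (x : J.ellipticSet) : 0 < Real.sin (J.quasiMomentum x) :=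
  Real.sin_pos_of_mem_Ioo (J.quasiMomentum_spec x).1

theorem monodromy_one_zero_ne_zero (x : J.ellipticSet) : J.monodromy x 1 0 ≠ 0 :=
  entry_ne_zero_of_abs_trace_lt (J.det_monodromy x) x.2

/-- The solution of `(J_T + Q) u = x u` with `u_1 = 1`, extended by `u_0 = 0`. -/
noncomputable def solution (q : ℕ → ℝ) (x : ℝ) : ℕ → ℝ
  | 0 => 0
  | 1 => 1
  | n + 2 => ((x - J.b ((n + 1 : ℕ) : ZMod T) - q (n + 1)) * solution q x (n + 1) -
      J.a ((n : ℕ) : ZMod T) * solution q x n) / J.a ((n + 1 : ℕ) : ZMod T)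

theorem solution_add_two (q : ℕ → ℝ) (x : ℝ) (n : ℕ) :
    J.solution q x (n + 2) =
      ((x - J.b ((n + 1 : ℕ) : ZMod T) - q (n + 1)) * J.solution q x (n + 1) -
        J.a ((n : ℕ) : ZMod T) * J.solution q x n) / J.a ((n + 1 : ℕ) : ZMod T) := by
  rw [solution]

theorem hasEigenvector_solution (q : ℕ → ℝ) (x : ℝ) :
    Module.End.HasEigenvector (J.op + diagOp fun n => q n) x
      (fun n : ℕ+ => J.solution q x n) := by
  rw [Module.End.hasEigenvector_iff, Module.End.mem_eigenspace_iff]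
  refine ⟨?_, fun h => ?_⟩
  · funext n
    obtain ⟨m, rfl⟩ : ∃ m : ℕ, n = m.succPNat := ⟨n.natPred, by simp⟩
    have ha := (J.a_pos ((m + 1 : ℕ) : ZMod T)).ne'
    have hrec : J.a ((m + 1 : ℕ) : ZMod T) * J.solution q x (m + 2) =
        (x - J.b ((m + 1 : ℕ) : ZMod T) - q (m + 1)) * J.solution q x (m + 1) -
        J.a ((m : ℕ) : ZMod T) * J.solution q x m := by
      rw [solution_add_two]
      field_simp
    -- The separate first row of `J.op` is absorbed by `u_0 = 0`.
    have hprev : (if m.succPNat = 1 then 0 else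
        J.a (((m.succPNat - 1 : ℕ+) : ℕ) : ZMod T) * J.solution q x (m.succPNat - 1 : ℕ+)) =
        J.a (m : ZMod T) * J.solution q x m := by
      rcases m with _ | m
      · rw [if_pos (show Nat.succPNat 0 = 1 from rfl), solution, mul_zero]
      · have h1 : (m + 1).succPNat ≠ 1 := fun h => by
          have := congrArg PNat.val h
          simp at this
        have h2 : (((m + 1).succPNat - 1 : ℕ+) : ℕ) = m + 1 := by
          rw [PNat.sub_coe, if_pos (by rw [← PNat.coe_lt_coe]; simp)]
          simp
        rw [if_neg h1, h2]
    change (if m.succPNat = 1 then 0 else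
        J.a (((m.succPNat - 1 : ℕ+) : ℕ) : ZMod T) * J.solution q x (m.succPNat - 1 : ℕ+)) +
      J.b ((m + 1 : ℕ) : ZMod T) * J.solution q x (m + 1) +
      J.a ((m + 1 : ℕ) : ZMod T) * J.solution q x (m + 2) +
      q (m + 1) * J.solution q x (m + 1) = x * J.solution q x (m + 1)
    rw [hprev, hrec]
    ring
  · have := congrFun h 1
    simp [solution] at this

/-- The potential that takes the value `x m` at `m T + 1` and vanishes off `1 + T ℕ`. -/
noncomputable def _root_.blockPotential (T : ℕ) (x : ℕ → ℝ) (n : ℕ) : ℝ :=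
  if T ∣ n - 1 then x ((n - 1) / T) else 0

/-- The state before a block of length `T`, after the shear caused by the potential. -/
noncomputable def blockState (x : ℕ → ℝ) (lam : ℝ) (m : ℕ) : Fin 2 → ℝ :=
  ![J.solution (blockPotential T x) lam (m * T) +
      x m / J.a 0 * J.solution (blockPotential T x) lam (m * T + 1),
    J.solution (blockPotential T x) lam (m * T + 1)]

/-- Subtracting `x m` from `lam - b_1` has the same effect as adding `x m / a_0 * u_1` to `u_0`
before the free `B_1`; the remaining steps of the block are free. -/
theorem solution_block (x : ℕ → ℝ) (lam : ℝ) (m : ℕ) {r : ℕ}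
    (hr : r < T) :
    ![J.solution (blockPotential T x) lam (m * T + (r + 1)),
      J.solution (blockPotential T x) lam (m * T + (r + 1) + 1)] =
    (J.transferProd lam (r + 1)).mulVec (J.blockState x lam m) := by
  have hcast : ∀ k : ℕ, ((m * T + k : ℕ) : ZMod T) = (k : ZMod T) := fun k => by simp
  induction r with
  | zero =>
    have hq : blockPotential T x (m * T + 1) = x m := by
      simp [blockPotential, Nat.mul_div_cancel _ hr]
    have hs := J.solution_add_two (blockPotential T x) lam (m * T)
    have ha := (J.a_pos 1).ne'
    have ha0 := (J.a_pos 0).ne'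
    rw [hcast 1, hq, show ((m * T : ℕ) : ZMod T) = 0 by simp, Nat.cast_one] at hs
    funext i
    fin_cases i
    · simp [transferProd, transfer, blockState]
    · simp [transferProd, transfer, blockState]
      rw [add_assoc, hs]
      field_simp
      ring
  | succ r ih =>
    have ih' := ih (by omega)
    have hq : blockPotential T x (m * T + (r + 1) + 1) = 0 := by
      rw [blockPotential, if_neg]
      rw [Nat.add_sub_cancel, Nat.dvd_add_right (Nat.dvd_mul_left _ _)]
      exact fun h => absurd (Nat.le_of_dvd (by omega) h) (by omega)
    have hs := J.solution_add_two (blockPotential T x) lam (m * T + (r + 1))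
    rw [hq, hcast (r + 1), show m * T + (r + 1) + 1 = m * T + (r + 1 + 1) by ring,
      hcast (r + 1 + 1)] at hs
    rw [transferProd, ← Matrix.mulVec_mulVec, ← ih']
    have ha := (J.a_pos ((r + 1 + 1 : ℕ) : ZMod T)).ne'
    have hidx : ((r + 1 + 1 : ℕ) : ZMod T) - 1 = ((r + 1 : ℕ) : ZMod T) := by
      push_cast; ring
    funext i
    fin_cases i
    · simp [transfer]
      rfl
    · simp only [transfer, hidx]
      simp only [Matrix.mulVec, dotProduct, Fin.sum_univ_two]
      change J.solution (blockPotential T x) lam (m * T + (r + 1) + 2) = _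
      rw [hs]
      simp [← add_assoc]
      field_simp
      ring

theorem solution_block_apply (x : ℕ → ℝ) (lam : ℝ) (m : ℕ) {r : ℕ} (hr : r < T) :
    J.solution (blockPotential T x) lam (m * T + r + 1) =
      (J.transferProd lam r).mulVec (J.blockState x lam m) 1 := by
  rcases r with _ | r
  · simp [transferProd, blockState]
  · rw [← J.solution_block x lam m (by omega)]
    rfl

/-- The solution at the beginning of the `m`-th block, in rotation coordinates. -/
noncomputable def blockCoord (x : ℕ → ℝ) (lam : J.ellipticSet) (m : ℕ) : ℂ :=
  rotationCoord (J.monodromy lam) (J.quasiMomentum lam)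
    ![J.solution (blockPotential T x) lam (m * T),
      J.solution (blockPotential T x) lam (m * T + 1)]

/-- The strength of the shear that the potential causes in rotation coordinates. -/
noncomputable def coupling (lam : J.ellipticSet) : ℝ :=
  J.monodromy lam 1 0 / (J.a 0 * Real.sin (J.quasiMomentum lam))

theorem coupling_ne_zero (lam : J.ellipticSet) : J.coupling lam ≠ 0 :=
  div_ne_zero (J.monodromy_one_zero_ne_zero lam)
    (mul_ne_zero (J.a_pos 0).ne' (J.sin_quasiMomentum_pos lam).ne')

/-- The shear adds `M 1 0 * x m / a_0 * u_1` to the coordinate, and `u_1` is its imaginary part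
divided by `sin θ`. -/
theorem rotationCoord_blockState (x : ℕ → ℝ) (lam : J.ellipticSet) (m : ℕ) :
    rotationCoord (J.monodromy lam) (J.quasiMomentum lam) (J.blockState x lam m) =
      imShear (x m * J.coupling lam) (J.blockCoord x lam m) := by
  have hs := (J.sin_quasiMomentum_pos lam).ne'
  have ha := (J.a_pos 0).ne'
  have h : x m * J.coupling lam * (Real.sin (J.quasiMomentum lam) *
      J.solution (blockPotential T x) lam (m * T + 1)) =
      J.monodromy lam 1 0 *
        (x m / J.a 0 * J.solution (blockPotential T x) lam (m * T + 1)) := by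
    rw [coupling]
    field_simp
  rw [imShear, blockCoord, rotationCoord_im]
  simp only [Matrix.cons_val_one, Matrix.cons_val_fin_one]
  rw [h]
  simp [rotationCoord, blockState]
  ring

theorem blockCoord_zero (x : ℕ → ℝ) (lam : J.ellipticSet) :
    J.blockCoord x lam 0 =
      rotationCoord (J.monodromy lam) (J.quasiMomentum lam) ![0, 1] := by
  simp [blockCoord, solution]

theorem blockCoord_succ (hT : 1 ≤ T) (x : ℕ → ℝ) (lam : J.ellipticSet) (m : ℕ) :
    J.blockCoord x lam (m + 1) = Complex.exp (J.quasiMomentum lam * Complex.I) *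
      imShear (x m * J.coupling lam) (J.blockCoord x lam m) := by
  have h := J.solution_block x lam m (r := T - 1) (by omega)
  rw [Nat.sub_add_cancel hT] at h
  rw [← rotationCoord_blockState, ← rotationCoord_mulVec (J.det_monodromy lam)
    (J.trace_monodromy lam), blockCoord, add_mul, one_mul, h]
  rfl

/-- Decay of the solution along blocks implies pointwise decay. -/
theorem exists_solution_le (hT : 1 ≤ T) (x : ℕ → ℝ) (lam : J.ellipticSet) {C : ℝ}
    (hC : ∀ m : ℕ, ‖J.blockCoord x lam m‖ * (m + 1) ≤ C) :
    ∃ C', ∀ n : ℕ+, |J.solution (blockPotential T x) lam n| * (n : ℕ) ≤ C' := by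
  obtain ⟨c, hc0, hc⟩ := exists_abs_le_norm_rotationCoord (J.monodromy_one_zero_ne_zero lam)
    (J.sin_quasiMomentum_pos lam).ne'
  let B : ℝ := ∑ r ∈ Finset.range T,
    (|J.transferProd lam r 1 0| + |J.transferProd lam r 1 1|)
  have hB : 0 ≤ B := Finset.sum_nonneg fun _ _ => by positivity
  refine ⟨B * c * T * C, fun n => ?_⟩
  obtain ⟨k, rfl⟩ : ∃ k : ℕ, n = k.succPNat := ⟨n.natPred, by simp⟩
  have hr : k % T < T := Nat.mod_lt _ hT
  have hk : k / T * T + k % T = k := Nat.div_add_mod' k T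
  set m := k / T
  set r := k % T
  -- The monodromy rotates the sheared state into the next block coordinate, so the shear itself
  -- needs no bound.
  have hnorm : ‖rotationCoord (J.monodromy lam) (J.quasiMomentum lam) (J.blockState x lam m)‖ =
      ‖J.blockCoord x lam (m + 1)‖ := by
    rw [J.blockCoord_succ hT, ← rotationCoord_blockState, norm_mul,
      Complex.norm_exp_ofReal_mul_I, one_mul]
  obtain ⟨h0, h1⟩ := hc (J.blockState x lam m)
  rw [hnorm] at h0 h1
  have hU : |J.solution (blockPotential T x) lam (k + 1)| ≤
      B * (c * ‖J.blockCoord x lam (m + 1)‖) := by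
    rw [← hk, J.solution_block_apply x lam m hr]
    simp only [Matrix.mulVec, dotProduct, Fin.sum_univ_two]
    calc _ ≤ |J.transferProd lam r 1 0| * |J.blockState x lam m 0| +
          |J.transferProd lam r 1 1| * |J.blockState x lam m 1| := by
            rw [← abs_mul, ← abs_mul]; exact abs_add_le _ _
      _ ≤ |J.transferProd lam r 1 0| * (c * ‖J.blockCoord x lam (m + 1)‖) +
          |J.transferProd lam r 1 1| * (c * ‖J.blockCoord x lam (m + 1)‖) := by gcongr
      _ = (|J.transferProd lam r 1 0| + |J.transferProd lam r 1 1|) *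
          (c * ‖J.blockCoord x lam (m + 1)‖) := by ring
      _ ≤ _ := by
        gcongr
        exact Finset.single_le_sum
          (f := fun r => |J.transferProd lam r 1 0| + |J.transferProd lam r 1 1|)
          (fun _ _ => by positivity) (Finset.mem_range.2 hr)
  have hk1 : ((k + 1 : ℕ) : ℝ) ≤ T * ((m + 1 : ℕ) + 1) := by
    have : k + 1 ≤ T * (m + 1 + 1) := by
      rw [← hk, mul_add, mul_add, mul_comm]
      omega
    exact_mod_cast this
  calc |J.solution (blockPotential T x) lam (k + 1)| * ((k + 1 : ℕ) : ℝ)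
      ≤ B * (c * ‖J.blockCoord x lam (m + 1)‖) * (T * ((m + 1 : ℕ) + 1)) := by gcongr
    _ = B * c * T * (‖J.blockCoord x lam (m + 1)‖ * ((m + 1 : ℕ) + 1)) := by ring
    _ ≤ _ := by gcongr; exact hC (m + 1)

end PeriodicJacobi

/-! ### Square summability and conclusion. -/

theorem memℓp_two_of_mul_le {u : ℕ+ → ℝ} {C : ℝ} (h : ∀ n : ℕ+, |u n| * (n : ℕ) ≤ C) :
    Memℓp u 2 := by
  refine memℓp_gen ?_
  have hs : Summable fun n : ℕ+ => C ^ 2 * (1 / ((n : ℕ) : ℝ) ^ 2) :=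
    ((Real.summable_one_div_nat_pow.2 one_lt_two).comp_injective PNat.coe_injective).mul_left _
  refine hs.of_nonneg_of_le (fun n => by positivity) fun n => ?_
  have hn : (0 : ℝ) < ((n : ℕ) : ℝ) := by exact_mod_cast n.pos
  have h2 : ‖u n‖ ^ (ENNReal.toReal 2) = |u n| ^ 2 := by simp
  rw [h2, mul_one_div, le_div_iff₀ (by positivity), ← mul_pow]
  exact pow_le_pow_left₀ (by positivity) (h n) 2

theorem tendsto_toPNat'_atTop : Tendsto Nat.toPNat' atTop atTop := tendsto_atTop.2 fun b => by
  filter_upwards [eventually_ge_atTop (b : ℕ)] with n hn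
  rw [← PNat.coe_le_coe, Nat.toPNat'_coe, if_pos (b.pos.trans_le hn)]
  exact hn

theorem theorem3p1 {T : ℕ} (hT : 1 ≤ T) (J : PeriodicJacobi T)
    (lam : ℕ → J.ellipticSet)
    (hlam : ∀ k : ℕ, LinearIndependent ℚ
      (Fin.cons Real.pi (fun i : Fin k => J.quasiMomentum (lam i)) : Fin (k + 1) → ℝ))
    (K : ℕ+ → ℝ) (hKpos : ∀ n, 0 < K n) (hK : Tendsto K atTop atTop) :
    ∃ q : ℕ+ → ℝ,
      (∀ n : ℕ+, |q n| ≤ K n / (n : ℕ)) ∧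
      Tendsto q atTop (𝓝 0) ∧
      (∀ n : ℕ+, ¬ (n : ℕ) ≡ 1 [MOD T] → q n = 0) ∧
      ∃ u : ℕ → ℕ+ → ℝ, ∀ i : ℕ,
        Memℓp (u i) 2 ∧
        Module.End.HasEigenvector (J.op + diagOp q) (lam i : ℝ) (u i) := by
  obtain ⟨x, hx0, hxK, hxt, z, hz0, hz, hzC⟩ := exists_kicks hT
    (K := fun n => K n.toPNat') (fun n => (hKpos _).le) (hK.comp tendsto_toPNat'_atTop)
    (ω := fun i => Complex.exp (J.quasiMomentum (lam i) * Complex.I))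
    (fun i => Complex.norm_exp_ofReal_mul_I _)
    (fun k h hp => prod_exp_sq_zpow_eq_one (hlam k) h hp)
    (κ := fun i => J.coupling (lam i)) (fun i => J.coupling_ne_zero _)
    (fun i => rotationCoord (J.monodromy (lam i)) (J.quasiMomentum (lam i)) ![0, 1])
  -- The kicked orbit and the block coordinates obey the same recursion from the same initial value.
  have hzU : ∀ i m, z m i = J.blockCoord x (lam i) m := fun i m => by
    induction m with
    | zero => rw [hz0, J.blockCoord_zero]
    | succ m ih => rw [hz, J.blockCoord_succ hT, ih]
  have hdiv : Tendsto (fun n : ℕ+ => ((n : ℕ) - 1) / T) atTop atTop :=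
    tendsto_atTop.2 fun b => by
      filter_upwards [eventually_ge_atTop (b * T + 1).toPNat'] with n hn
      rw [← PNat.coe_le_coe, Nat.toPNat'_coe, if_pos (by omega)] at hn
      rw [Nat.le_div_iff_mul_le hT]
      omega
  refine ⟨fun n => blockPotential T x n, fun n => ?_, ?_, fun n hn => ?_,
    fun i n => J.solution (blockPotential T x) (lam i) n, fun i => ⟨?_, ?_⟩⟩
  · simp only [blockPotential]
    split_ifs with h
    · have hn : ((n : ℕ) - 1) / T * T + 1 = n := by
        rw [Nat.div_mul_cancel h]
        exact Nat.sub_add_cancel n.pos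
      have := hxK (((n : ℕ) - 1) / T)
      rw [hn] at this
      rw [abs_of_nonneg (hx0 _)]
      simpa using this
    · rw [abs_zero]
      exact div_nonneg (hKpos n).le (Nat.cast_nonneg _)
  · refine squeeze_zero (fun n => ?_) (fun n => ?_) (hxt.comp hdiv)
    · simp only [blockPotential]
      split_ifs
      exacts [hx0 _, le_rfl]
    · simp only [blockPotential, Function.comp_apply]
      split_ifs
      exacts [le_rfl, hx0 _]
  · exact if_neg fun h => hn ((Nat.modEq_iff_dvd' n.pos).2 h).symm
  · obtain ⟨C, hC⟩ := hzC i
    simp_rw [hzU] at hC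
    obtain ⟨C', hC'⟩ := J.exists_solution_le hT x (lam i) hC
    exact memℓp_two_of_mul_le hC'
  · exact J.hasEigenvector_solution _ _
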